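/- Let $G$ be a countable discrete amenable group, i.e. for every non-empty finite $K\subseteq G$ and $\delta>0$ there is a non-empty finite $F\subseteq G$ with $|F\,\Delta\,KF|<\delta|F|$. A Følner sequence of $G$ is a sequence $(F_n)$ of non-empty finite subsets with $\lim_{n\to\infty}|gF_n\,\Delta\,F_n|/|F_n|=0$ for every $g\in G$. Let $G$ act by measure-preserving transformations on an arbitrary probability space $(Y,\mathcal D,\nu)$, and let $\mathcal C\subseteq\mathcal D$ be a sub-$\sigma$-algebra that is $G$-invariant, i.e. $g^{-1}\mathcal C=\mathcal C$ up to $\nu$-null sets for each $g\in G$. For a finite measurable partition $\alpha$ of $Y$ and a sub-$\sigma$-algebra $\mathcal A\subseteq\mathcal D$ put $$H_\nu(\alpha|\mathcal A)=-\sum_{A\in\alpha}\int_Y \nu(A|\mathcal A)\log\nu(A|\mathcal A)\,d\nu ,\qquad 0\log 0=0,$$ where $\nu(A|\mathcal A)$ is the conditional expectation of $1_A$ given $\mathcal A$. For finite $F\subseteq G$ let $\alpha_F=\bigvee_{g\in F}g^{-1}\alpha$; partitions also denote the $\sigma$-algebras they generate, and $\beta_G$ is the $\sigma$-algebra generated by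 all $g^{-1}\beta$, $g\in G$. For $G$-invariant $\mathcal A$ let $$h_\nu(G,\alpha|\mathcal A)=\lim_{n\to\infty}\frac1{|F_n|}H_\nu(\alpha_{F_n}|\mathcal A)$$ be the limit along a Følner sequence $(F_n)$ of $G$. Theorem. Let $\alpha,\beta$ be finite measurable partitions of $Y$. The limits defining $h_\nu(G,\alpha\vee\beta|\mathcal C)$, $h_\nu(G,\beta|\mathcal C)$ and $h_\nu(G,\alpha|\beta_G\vee\mathcal C)$ exist and do not depend on the Følner sequence; for every Følner sequence $(F_n)$ of $G$, $$\lim_{n\to\infty}\frac1{|F_n|}H_\nu(\alpha_{F_n}|\beta_{F_n}\vee\mathcal C)=h_\nu(G,\alpha|\beta_G\vee\mathcal C);$$ and consequently $$h_\nu(G,\alpha\vee\beta|\mathcal C)=h_\nu(G,\beta|\mathcal C)+h_\nu(G,\alpha|\beta_G\vee\mathcal C).$$ -/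

import Mathlib

open MeasureTheory Filter Topology
open scoped Pointwise symmDiff

/-- A (discrete) group is amenable if for every non-empty finite `K` and every `δ > 0` there is a
non-empty finite `F` with `|F ∆ K F| < δ |F|`. -/
def IsAmenableGroup (G : Type*) [Group G] : Prop :=
  ∀ K : Finset G, K.Nonempty → ∀ δ : ℝ, 0 < δ →
    ∃ F : Finset G, F.Nonempty ∧
      (((F : Set G) ∆ ((K : Set G) * (F : Set G))).ncard : ℝ) < δ * (F.card : ℝ)

/-- A Følner sequence: non-empty finite sets `F n` with `|g F n ∆ F n| / |F n| → 0` for all `g`. -/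
structure IsFolnerSeq {G : Type*} [Group G] (F : ℕ → Finset G) : Prop where
  nonempty : ∀ n, (F n).Nonempty
  tendsto : ∀ g : G, Tendsto
    (fun n => (((g • (F n : Set G)) ∆ (F n : Set G)).ncard : ℝ) / ((F n).card : ℝ)) atTop (𝓝 0)

/-- A measurable partition of `Y`, written as a family of pairwise disjoint measurable sets indexed
by `ι` that covers `Y` (members may be empty). It is a finite partition when `ι` is finite. -/
structure MeasPartition (ι Y : Type*) [MeasurableSpace Y] where
  part : ι → Set Y
  measurable_part : ∀ i, MeasurableSet (part i)
  disjoint_part : ∀ i j, i ≠ j → Disjoint (part i) (part j)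
  iUnion_part : ⋃ i, part i = Set.univ

namespace MeasPartition

/-- The join `α ∨ β`, with members `A i ∩ B j`. -/
def join {ι κ Y : Type*} [MeasurableSpace Y] (α : MeasPartition ι Y) (β : MeasPartition κ Y) :
    MeasPartition (ι × κ) Y where
  part p := α.part p.1 ∩ β.part p.2
  measurable_part p := (α.measurable_part p.1).inter (β.measurable_part p.2)
  disjoint_part := by
    rintro ⟨i, j⟩ ⟨i', j'⟩ h
    by_cases hi : i = i'
    · have hj : j ≠ j' := fun hj => h (by rw [hi, hj])
      exact (β.disjoint_part j j' hj).mono Set.inter_subset_right Set.inter_subset_right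
    · exact (α.disjoint_part i i' hi).mono Set.inter_subset_left Set.inter_subset_left
  iUnion_part := by
    refine Set.eq_univ_of_forall fun y => ?_
    obtain ⟨i, hi⟩ := Set.mem_iUnion.1 (α.iUnion_part.symm ▸ Set.mem_univ y)
    obtain ⟨j, hj⟩ := Set.mem_iUnion.1 (β.iUnion_part.symm ▸ Set.mem_univ y)
    exact Set.mem_iUnion.2 ⟨(i, j), hi, hj⟩

/-- `α_F`, the join of the partitions `g⁻¹ α` for `g ∈ F`, where `g⁻¹ A = {y | g • y ∈ A}`: its
members are the intersections of the `g⁻¹ (A (φ g))` over `g ∈ F`, for `φ : F → ι`. -/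
def iter {ι Y G : Type*} [MeasurableSpace Y] [Group G] [MulAction G Y] [MeasurableConstSMul G Y]
    (α : MeasPartition ι Y) (F : Finset G) : MeasPartition (F → ι) Y where
  part φ := ⋂ g : F, (fun y : Y => (g : G) • y) ⁻¹' α.part (φ g)
  measurable_part φ := MeasurableSet.iInter fun g =>
    measurable_const_smul (g : G) (α.measurable_part (φ g))
  disjoint_part := by
    intro φ ψ h
    obtain ⟨g, hg⟩ := Function.ne_iff.1 h
    exact ((α.disjoint_part _ _ hg).preimage _).mono
      (Set.iInter_subset _ g) (Set.iInter_subset _ g)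
  iUnion_part := by
    refine Set.eq_univ_of_forall fun y => ?_
    have h : ∀ g : F, ∃ i, (g : G) • y ∈ α.part i := fun g =>
      Set.mem_iUnion.1 (α.iUnion_part.symm ▸ Set.mem_univ ((g : G) • y))
    choose φ hφ using h
    exact Set.mem_iUnion.2 ⟨φ, Set.mem_iInter.2 hφ⟩

/-- The `σ`-algebra generated by the members of a partition. -/
abbrev sigma {ι Y : Type*} [MeasurableSpace Y] (α : MeasPartition ι Y) : MeasurableSpace Y :=
  MeasurableSpace.generateFrom (Set.range α.part)

/-- `β_G`, the `σ`-algebra generated by all the partitions `g⁻¹ β`, `g ∈ G`. -/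
abbrev sigmaGroup {ι Y : Type*} [MeasurableSpace Y] (β : MeasPartition ι Y) (G : Type*) [Group G]
    [MulAction G Y] : MeasurableSpace Y :=
  MeasurableSpace.generateFrom {S | ∃ (g : G) (i : ι), S = (fun y : Y => g • y) ⁻¹' β.part i}

end MeasPartition

/-- `g⁻¹ C = C` up to `ν`-null sets, for every `g`. -/
def IsInvariantSigma (G : Type*) {Y : Type*} [Group G] [MulAction G Y] (C : MeasurableSpace Y)
    [MeasurableSpace Y] (ν : Measure Y) : Prop :=
  ∀ g : G,
    (∀ A : Set Y, MeasurableSet[C] A →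
      ∃ B : Set Y, MeasurableSet[C] B ∧ (fun y : Y => g • y) ⁻¹' A =ᵐ[ν] B) ∧
    (∀ B : Set Y, MeasurableSet[C] B →
      ∃ A : Set Y, MeasurableSet[C] A ∧ (fun y : Y => g • y) ⁻¹' A =ᵐ[ν] B)

/-- Conditional Shannon entropy `H_ν(α | C) = - ∑ i, ∫ ν(A i | C) log ν(A i | C) dν` of a finite
partition; `Real.negMulLog x = - x * log x`, with value `0` at `0`. -/
noncomputable def condEntropy {ι Y : Type*} [Finite ι] (C : MeasurableSpace Y) [MeasurableSpace Y]
    (ν : Measure Y) (α : MeasPartition ι Y) : ℝ :=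
  ∑ᶠ i, ∫ y, Real.negMulLog ((ν[(α.part i).indicator (fun _ => (1 : ℝ)) | C]) y) ∂ν

/-- `l` is the limit of `H_ν(α_{F n} | C) / |F n|` along every Følner sequence of `G`. -/
def HasDynEntropy (G : Type*) {ι Y : Type*} [Finite ι] [Group G] [MulAction G Y]
    (C : MeasurableSpace Y) [MeasurableSpace Y] [MeasurableConstSMul G Y] (ν : Measure Y)
    (α : MeasPartition ι Y) (l : ℝ) : Prop :=
  ∀ F : ℕ → Finset G, IsFolnerSeq F →
    Tendsto (fun n => condEntropy C ν (α.iter (F n)) / ((F n).card : ℝ)) atTop (𝓝 l)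

/-- `h_ν(G, α | C)`: the limit of `H_ν(α_{F n} | C) / |F n|` along Følner sequences of `G`. -/
noncomputable def dynEntropy (G : Type*) {ι Y : Type*} [Finite ι] [Group G] [MulAction G Y]
    (C : MeasurableSpace Y) [MeasurableSpace Y] [MeasurableConstSMul G Y] (ν : Measure Y)
    (α : MeasPartition ι Y) : ℝ :=
  Classical.epsilon fun l : ℝ => HasDynEntropy G C ν α l

/-! By the chain rule `condEntropy_join`, H(α_F | β_F ∨ C) = H((α ∨ β)_F | C) - H(β_F | C), so
everything rests on the behaviour of S ↦ H(α_S | m). This set function is monotone and submodular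
(`isSubmodularRank_condEntropy`), and Shearer's inequality, averaged over right translates K c
inside a Følner set F, bounds its value at F, divided by |F|, by its value at K, divided by |K|, up
to a boundary error (`IsSubmodularRank.card_mul_le`). If m is invariant, the normalized values
therefore converge to their infimum. This yields the limits a for α ∨ β and b for β over C, and
H(α_F | β_F ∨ C)/|F| → a - b.

It remains to replace β_F by β_G. Since β_F ⊆ β_G, the entropy given β_G ∨ C is at most that given
β_F ∨ C, which is the upper bound. For the lower bound, martingale convergence approximates β_G by
β_E with E finite. If K c and E c lie in F, then H(α_{K c} | β_F ∨ C) ≤ H(α_{K c} | β_{E c} ∨ C) =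
H(α_K | β_E ∨ C), and averaging over c gives a - b ≤ H(α_K | β_G ∨ C)/|K| for every non-empty finite
K (`le_condEntropy_sigmaGroup_div_card`). Taking K = F n squeezes the sequence to a - b. -/

/-- A normalized, monotone and submodular function on finite sets. -/
structure IsSubmodularRank {G : Type*} [DecidableEq G] (h : Finset G → ℝ) : Prop where
  empty : h ∅ = 0
  le_insert : ∀ g S, g ∉ S → h S ≤ h (insert g S)
  insert_sub_le : ∀ g S T, S ⊆ T → g ∉ T → h (insert g T) - h T ≤ h (insert g S) - h S

/-! ### Submodular set functions and Shearer's inequality. -/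

namespace IsSubmodularRank

variable {G : Type*} [DecidableEq G] {h : Finset G → ℝ}

theorem nonneg (hh : IsSubmodularRank h) (S : Finset G) : 0 ≤ h S := by
  induction S using Finset.induction_on with
  | empty => exact hh.empty.ge
  | insert g S hg ih => exact ih.trans (hh.le_insert g S hg)

theorem le_card_mul (hh : IsSubmodularRank h) {b : ℝ} (hb : ∀ g, h {g} ≤ b) (S : Finset G) :
    h S ≤ S.card * b := by
  induction S using Finset.induction_on with
  | empty => simp [hh.empty]
  | insert g S hg ih =>
    have h1 := hh.insert_sub_le g ∅ S (Finset.empty_subset S) hg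
    have h2 := hb g
    rw [Finset.card_insert_of_notMem hg]
    simp only [hh.empty, LawfulSingleton.insert_empty_eq] at h1
    push_cast
    linarith

/-- Shearer's inequality for submodular set functions. -/
theorem card_mul_le_sum_inter (hh : IsSubmodularRank h) {J : Type*} (I : Finset J)
    (S : J → Finset G) (k : ℕ) (F : Finset G)
    (hk : ∀ f ∈ F, k ≤ (I.filter fun c => f ∈ S c).card) :
    k * h F ≤ ∑ c ∈ I, h (S c ∩ F) := by
  induction F using Finset.induction_on with
  | empty => simp [hh.empty]
  | insert f F hf ih =>
    have ih' := ih fun f hf => hk f (Finset.mem_insert_of_mem hf)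
    -- By submodularity, adding `f` to the smaller set `S c ∩ F` gains at least `d`, and this
    -- happens for at least `k` indices `c`.
    set d := h (insert f F) - h F with hd
    have hd0 : 0 ≤ d := sub_nonneg.2 (hh.le_insert f F hf)
    have hterm : ∀ c ∈ I, h (S c ∩ F) + (if f ∈ S c then d else 0) ≤ h (S c ∩ insert f F) := by
      intro c _
      by_cases hc : f ∈ S c
      · have h1 := hh.insert_sub_le f (S c ∩ F) F Finset.inter_subset_right hf
        rw [if_pos hc, Finset.inter_insert_of_mem hc]
        linarith
      · rw [if_neg hc, Finset.inter_insert_of_notMem hc, add_zero]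
    have hsum := Finset.sum_le_sum hterm
    rw [Finset.sum_add_distrib, ← Finset.sum_filter, Finset.sum_const, nsmul_eq_mul] at hsum
    have hcard : (k : ℝ) ≤ ((I.filter fun c => f ∈ S c).card : ℝ) := by
      exact_mod_cast hk f (Finset.mem_insert_self f F)
    have := mul_le_mul_of_nonneg_right hcard hd0
    have hF : h (insert f F) = h F + d := by rw [hd]; ring
    rw [hF, mul_add]
    linarith

end IsSubmodularRank

/-! ### Følner sequences and averaging over translates. -/

section Folner

variable {G : Type*} [Group G]

/-- `∑ g ∈ P, |g F ∆ F|`, the size of the boundary of `F` relative to `P`. -/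
noncomputable def folnerBoundary (P F : Finset G) : ℝ :=
  ∑ g ∈ P, (((g • (F : Set G)) ∆ (F : Set G)).ncard : ℝ)

theorem IsFolnerSeq.tendsto_folnerBoundary {F : ℕ → Finset G} (hF : IsFolnerSeq F)
    (P : Finset G) :
    Tendsto (fun n => folnerBoundary P (F n) / ((F n).card : ℝ)) atTop (𝓝 0) := by
  simp only [folnerBoundary, Finset.sum_div]
  simpa using tendsto_finsetSum P fun g _ => hF.tendsto g

theorem IsFolnerSeq.card_pos {F : ℕ → Finset G} (hF : IsFolnerSeq F) (n : ℕ) :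
    (0 : ℝ) < (F n).card := by
  exact_mod_cast (hF.nonempty n).card_pos

theorem IsAmenableGroup.exists_isFolnerSeq [Countable G] (hG : IsAmenableGroup G) :
    ∃ F : ℕ → Finset G, IsFolnerSeq F := by
  classical
  obtain ⟨e, he⟩ := exists_surjective_nat G
  -- The element 1 only keeps `K 0` non-empty.
  set K : ℕ → Finset G := fun n => insert 1 ((Finset.range n).image e) with hK
  have hδ : ∀ n : ℕ, (0 : ℝ) < 1 / ((n : ℝ) + 1) := fun n => by positivity
  choose F hFne hF using fun n => hG (K n) ⟨1, Finset.mem_insert_self _ _⟩ _ (hδ n)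
  refine ⟨F, hFne, fun g => ?_⟩
  obtain ⟨N, rfl⟩ := he g
  have hlim : Tendsto (fun n : ℕ => 2 * (1 / ((n : ℝ) + 1))) atTop (𝓝 0) := by
    simpa using (tendsto_one_div_add_atTop_nhds_zero_nat (𝕜 := ℝ)).const_mul 2
  refine squeeze_zero' (Eventually.of_forall fun n => by positivity) ?_ hlim
  filter_upwards [eventually_gt_atTop N] with n hn
  have hpos : (0 : ℝ) < (F n).card := by exact_mod_cast (hFne n).card_pos
  rw [div_le_iff₀ hpos]
  have hmem : e N ∈ K n :=
    Finset.mem_insert_of_mem (Finset.mem_image_of_mem e (Finset.mem_range.2 hn))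
  have h1 : ((e N • F n) \ F n) ⊆ F n ∆ (K n * F n) := by
    intro x hx
    obtain ⟨hx1, hx2⟩ := Finset.mem_sdiff.1 hx
    obtain ⟨f, hf, rfl⟩ := Finset.mem_smul_finset.1 hx1
    exact Finset.mem_symmDiff.2 (Or.inr ⟨Finset.mul_mem_mul hmem hf, hx2⟩)
  -- Both halves of the symmetric difference have equal size because translation preserves
  -- cardinality; hence the factor 2.
  have h2 : ((F n \ (e N • F n))).card = ((e N • F n) \ F n).card :=
    Finset.card_sdiff_comm (Finset.card_smul_finset _ _).symm
  have h3 : ((e N • F n) ∆ F n).card ≤ 2 * (F n ∆ (K n * F n)).card := by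
    calc _ ≤ ((e N • F n) \ F n).card + ((F n \ (e N • F n))).card := Finset.card_union_le _ _
      _ ≤ _ := by
        rw [h2]
        have := Finset.card_le_card h1
        omega
  have h4 := (hF n).le
  rw [← Finset.coe_mul, ← Finset.coe_symmDiff, Set.ncard_coe_finset] at h4
  rw [← Finset.coe_smul_finset, ← Finset.coe_symmDiff, Set.ncard_coe_finset]
  have h5 : (((e N • F n) ∆ F n).card : ℝ) ≤ 2 * ((F n ∆ (K n * F n)).card : ℝ) := by
    exact_mod_cast h3
  linarith

variable [DecidableEq G]

theorem card_smul_sdiff_le_ncard (g : G) (F : Finset G) :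
    (((g • F) \ F).card : ℝ) ≤ (((g • (F : Set G)) ∆ (F : Set G)).ncard : ℝ) := by
  rw [← Finset.coe_smul_finset, ← Finset.coe_symmDiff, Set.ncard_coe_finset]
  exact_mod_cast Finset.card_le_card (Finset.subset_union_left)

theorem card_sum_smul_sdiff_le {P Q : Finset G} (hPQ : P ⊆ Q) (F : Finset G) :
    ((∑ g ∈ P, ((g • F) \ F).card : ℕ) : ℝ) ≤ folnerBoundary Q F := by
  push_cast
  exact (Finset.sum_le_sum fun g _ => card_smul_sdiff_le_ncard g F).trans
    (Finset.sum_le_sum_of_subset_of_nonneg hPQ fun _ _ _ => Nat.cast_nonneg _)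

/-- Averaging a submodular function on `F` over the translates `K c`: those `c` for which
`K c` and `E c` are not contained in `F` are controlled by the boundary of `F`. -/
theorem IsSubmodularRank.card_mul_le {h : Finset G → ℝ} (hh : IsSubmodularRank h) {b : ℝ}
    (hb : ∀ g, h {g} ≤ b) (K E F : Finset G) {a : ℝ} (ha : 0 ≤ a)
    (hgood : ∀ c, (∀ k ∈ K, k * c ∈ F) → (∀ e ∈ E, e * c ∈ F) →
      h (K.image fun k => k * c) ≤ a) :
    K.card * h F ≤ F.card * a +
      K.card * b * (2 * folnerBoundary (K ∪ E ∪ K⁻¹) F) := by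
  classical
  by_cases hF : F = ∅
  · subst hF
    simp [hh.empty, folnerBoundary]
  obtain ⟨f₀, hf₀⟩ := Finset.nonempty_iff_ne_empty.2 hF
  have hb0 : 0 ≤ b := (hh.nonneg {f₀}).trans (hb f₀)
  -- These are the `c` whose translate `K c` meets `F`; each `f` in `F` is covered |K| times, by `c
  -- = k⁻¹ * f`.
  set I : Finset G := K⁻¹ * F with hI
  -- Demanding `c ∈ F` caps the number of good translates at |F|.
  set good : G → Prop := fun c => c ∈ F ∧ ∀ p ∈ K ∪ E, p * c ∈ F with hgd
  have hcover : ∀ f ∈ F, K.card ≤ (I.filter fun c => f ∈ K.image fun k => k * c).card := by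
    intro f hf
    refine Finset.card_le_card_of_injOn (fun k => k⁻¹ * f) ?_ ?_
    · intro k hk
      simp only [Finset.coe_filter, Set.mem_ofPred_eq, Finset.mem_image]
      exact ⟨Finset.mul_mem_mul (Finset.inv_mem_inv hk) hf, k, hk, by group⟩
    · intro k _ k' _ hkk
      simpa using hkk
  have hS := hh.card_mul_le_sum_inter I (fun c => K.image fun k => k * c) K.card F hcover
  rw [← Finset.sum_filter_add_sum_filter_not I good] at hS
  have h1 : ∑ c ∈ I.filter good, h ((K.image fun k => k * c) ∩ F) ≤ F.card * a := by
    calc _ ≤ ∑ c ∈ I.filter good, a := by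
          refine Finset.sum_le_sum fun c hc => ?_
          have hc' : ∀ p ∈ K ∪ E, p * c ∈ F := by
            have hc₁ : good c := (Finset.mem_filter.1 hc).2
            exact hc₁.2
          have hK : ∀ k ∈ K, k * c ∈ F := fun k hk =>
            hc' k (Finset.mem_union_left _ hk)
          have hsub : (K.image fun k => k * c) ⊆ F := by
            intro x hx
            obtain ⟨k, hk, rfl⟩ := Finset.mem_image.1 hx
            exact hK k hk
          rw [Finset.inter_eq_left.2 hsub]
          exact hgood c hK fun e he => hc' e (Finset.mem_union_right _ he)
      _ ≤ F.card * a := by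
          rw [Finset.sum_const, nsmul_eq_mul]
          refine mul_le_mul_of_nonneg_right ?_ ha
          refine Nat.cast_le.2 (Finset.card_le_card fun c hc => ?_)
          have hc₁ : good c := (Finset.mem_filter.1 hc).2
          exact hc₁.1
  have h2 : ∑ c ∈ I.filter (fun c => ¬ good c), h ((K.image fun k => k * c) ∩ F) ≤
      (I.filter (fun c => ¬ good c)).card * (K.card * b) := by
    rw [← nsmul_eq_mul]
    refine Finset.sum_le_card_nsmul _ _ _ fun c _ => ?_
    refine (hh.le_card_mul hb _).trans (mul_le_mul_of_nonneg_right ?_ hb0)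
    exact_mod_cast (Finset.card_le_card Finset.inter_subset_left).trans Finset.card_image_le
  have h3 : ((I.filter (fun c => ¬ good c)).card : ℝ) ≤
      2 * folnerBoundary (K ∪ E ∪ K⁻¹) F := by
    -- A bad `c` is either outside `F`, hence in some k⁻¹F \ F, or in `F` with `p * c` outside,
    -- hence in p⁻¹(pF \ F). Each of the two kinds costs at most one boundary.
    have hsub : I.filter (fun c => ¬ good c) ⊆
        (K⁻¹.biUnion fun p => (p • F) \ F) ∪
          ((K ∪ E).biUnion fun p => p⁻¹ • ((p • F) \ F)) := by
      intro c hc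
      obtain ⟨hcI, hcg⟩ := Finset.mem_filter.1 hc
      by_cases hcF : c ∈ F
      · have : ∃ p ∈ K ∪ E, p * c ∉ F := by
          by_contra! hcon
          exact hcg ⟨hcF, hcon⟩
        obtain ⟨p, hp, hpc⟩ := this
        refine Finset.mem_union_right _ (Finset.mem_biUnion.2 ⟨p, hp, ?_⟩)
        rw [Finset.mem_inv_smul_finset_iff, Finset.mem_sdiff]
        exact ⟨Finset.smul_mem_smul_finset hcF, hpc⟩
      · obtain ⟨p, hp, f, hf, rfl⟩ := Finset.mem_mul.1 hcI
        refine Finset.mem_union_left _ (Finset.mem_biUnion.2 ⟨p, hp, ?_⟩)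
        exact Finset.mem_sdiff.2 ⟨Finset.smul_mem_smul_finset hf, hcF⟩
    have hcard : (I.filter (fun c => ¬ good c)).card ≤
        (∑ p ∈ K⁻¹, ((p • F) \ F).card) + ∑ p ∈ K ∪ E, ((p • F) \ F).card := by
      refine (Finset.card_le_card hsub).trans ((Finset.card_union_le _ _).trans ?_)
      refine add_le_add Finset.card_biUnion_le (Finset.card_biUnion_le.trans ?_)
      simp [Finset.card_smul_finset]
    have e1 := card_sum_smul_sdiff_le (P := K⁻¹) (Q := K ∪ E ∪ K⁻¹) Finset.subset_union_right F
    have e2 := card_sum_smul_sdiff_le (P := K ∪ E) (Q := K ∪ E ∪ K⁻¹) Finset.subset_union_left F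
    have : ((I.filter (fun c => ¬ good c)).card : ℝ) ≤
        ((∑ p ∈ K⁻¹, ((p • F) \ F).card : ℕ) : ℝ) +
          ((∑ p ∈ K ∪ E, ((p • F) \ F).card : ℕ) : ℝ) := by exact_mod_cast hcard
    linarith
  have h4 := mul_le_mul_of_nonneg_right h3 (mul_nonneg (Nat.cast_nonneg K.card) hb0)
  calc _ ≤ _ := hS
    _ ≤ F.card * a + (I.filter (fun c => ¬ good c)).card * (K.card * b) := add_le_add h1 h2
    _ ≤ _ := by linarith

/-- Along a Følner sequence, normalized submodular functions `h n` are eventually at most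
`a / |K| + ε` as soon as `a` bounds `h n` on the translates `K c` with `K c, E c ⊆ F n`. -/
theorem IsFolnerSeq.eventually_div_card_le {F : ℕ → Finset G} (hF : IsFolnerSeq F)
    {h : ℕ → Finset G → ℝ} (hh : ∀ n, IsSubmodularRank (h n)) {b : ℝ} (hb : ∀ n g, h n {g} ≤ b)
    {K : Finset G} (hK : K.Nonempty) (E : Finset G) {a : ℝ} (ha : 0 ≤ a)
    (hgood : ∀ n c, (∀ k ∈ K, k * c ∈ F n) → (∀ e ∈ E, e * c ∈ F n) →
      h n (K.image fun k => k * c) ≤ a) {ε : ℝ} (hε : 0 < ε) :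
    ∀ᶠ n in atTop, h n (F n) / (F n).card ≤ a / K.card + ε := by
  have hlim : Tendsto (fun n => 2 * b * (folnerBoundary (K ∪ E ∪ K⁻¹) (F n) / ((F n).card : ℝ)))
      atTop (𝓝 0) := by
    simpa using (hF.tendsto_folnerBoundary (K ∪ E ∪ K⁻¹)).const_mul (2 * b)
  filter_upwards [hlim.eventually_lt_const hε] with n hn
  have hFn := hF.card_pos n
  have hKc : (0 : ℝ) < K.card := by exact_mod_cast hK.card_pos
  have key := (hh n).card_mul_le (hb n) K E (F n) ha (hgood n)
  have : h n (F n) / (F n).card ≤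
      a / K.card + 2 * b * (folnerBoundary (K ∪ E ∪ K⁻¹) (F n) / ((F n).card : ℝ)) := by
    rw [div_le_iff₀ hFn, ← mul_le_mul_iff_right₀ hKc]
    refine key.trans (le_of_eq ?_)
    field_simp
  linarith

/-- For a right-invariant submodular function the normalized limit along Følner sequences exists
and does not depend on the sequence. -/
theorem IsSubmodularRank.exists_tendsto {h : Finset G → ℝ} (hh : IsSubmodularRank h)
    (hinv : ∀ (K : Finset G) (c : G), h (K.image fun k => k * c) = h K) :
    ∃ l : ℝ, ∀ F : ℕ → Finset G, IsFolnerSeq F →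
      Tendsto (fun n => h (F n) / ((F n).card : ℝ)) atTop (𝓝 l) := by
  -- The limit is the infimum of `V`: each `F n` is itself a competitor, and the averaging bound
  -- with `E = ∅` compares `F n` with any near-optimal `K`.
  set V : Set ℝ := {x | ∃ K : Finset G, K.Nonempty ∧ x = h K / K.card} with hV
  have hbdd : BddBelow V := by
    refine ⟨0, ?_⟩
    rintro x ⟨K, -, rfl⟩
    exact div_nonneg (hh.nonneg K) (Nat.cast_nonneg _)
  have hne : V.Nonempty := ⟨_, {1}, Finset.singleton_nonempty 1, rfl⟩
  refine ⟨sInf V, fun F hF => ?_⟩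
  rw [tendsto_order]
  constructor
  · intro x hx
    exact Eventually.of_forall fun n => hx.trans_le (csInf_le hbdd ⟨F n, hF.nonempty n, rfl⟩)
  · intro x hx
    obtain ⟨y, ⟨K, hK, rfl⟩, hyx⟩ := exists_lt_of_csInf_lt hne hx
    have hb : ∀ g, h {g} ≤ h {1} := fun g => by
      have := hinv {1} g
      simp only [Finset.image_singleton, one_mul] at this
      exact this.le
    filter_upwards [hF.eventually_div_card_le (fun _ => hh) (fun _ => hb) hK ∅ (hh.nonneg K)
      (fun _ c _ _ => (hinv K c).le) (half_pos (sub_pos.2 hyx))] with n hn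
    linarith

end Folner

/-! ### Conditional probabilities: Bayes' rule and equivariance. -/

section CondProb

/-- Sets measurable up to null sets with respect to `m`. -/
abbrev aeMeasurableSpace {Y : Type*} (m : MeasurableSpace Y) [MeasurableSpace Y] (ν : Measure Y) : MeasurableSpace Y where
  MeasurableSet' S := MeasurableSet S ∧ ∃ T, MeasurableSet[m] T ∧ S =ᵐ[ν] T
  measurableSet_empty := ⟨MeasurableSet.empty, ∅, @MeasurableSet.empty Y m, by rfl⟩
  measurableSet_compl := by
    rintro S ⟨hS, T, hT, hST⟩
    exact ⟨hS.compl, Tᶜ, hT.compl, hST.compl⟩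
  measurableSet_iUnion := by
    intro S hS
    choose hS T hT hST using hS
    exact ⟨MeasurableSet.iUnion hS, ⋃ n, T n, MeasurableSet.iUnion hT,
      Filter.EventuallyEq.countable_iUnion hST⟩

variable {Y : Type*} {m m' : MeasurableSpace Y} [D : MeasurableSpace Y] {ν : Measure Y}

theorem integrable_indicator_one [IsFiniteMeasure ν] {s : Set Y} (hs : MeasurableSet s) :
    Integrable (s.indicator fun _ => (1 : ℝ)) ν :=
  (integrable_const 1).indicator hs

theorem condExp_indicator_nonneg (s : Set Y) :
    0 ≤ᵐ[ν] ν[s.indicator (fun _ => (1 : ℝ)) | m] :=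
  condExp_nonneg (Eventually.of_forall fun y => Set.indicator_nonneg (fun _ _ => zero_le_one) y)

theorem condExp_indicator_mono [IsFiniteMeasure ν] {s t : Set Y} (hs : MeasurableSet s) (ht : MeasurableSet t)
    (hst : s ⊆ t) :
    ν[s.indicator (fun _ => (1 : ℝ)) | m] ≤ᵐ[ν] ν[t.indicator (fun _ => (1 : ℝ)) | m] :=
  condExp_mono (integrable_indicator_one hs) (integrable_indicator_one ht)
    (Eventually.of_forall fun y =>
      Set.indicator_le_indicator_of_subset hst (fun _ => zero_le_one) y)

theorem aeMeasurableSpace_le : aeMeasurableSpace m ν ≤ D := fun _ hS => hS.1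

theorem le_aeMeasurableSpace (hm : m ≤ D) : m ≤ aeMeasurableSpace m ν :=
  fun S hS => ⟨hm S hS, S, hS, by rfl⟩

variable [IsProbabilityMeasure ν]

theorem condExp_indicator_le_one (hm : m ≤ D) {s : Set Y} (hs : MeasurableSet s) :
    ν[s.indicator (fun _ => (1 : ℝ)) | m] ≤ᵐ[ν] fun _ => 1 := by
  have := condExp_indicator_mono (ν := ν) (m := m) hs MeasurableSet.univ (Set.subset_univ s)
  rwa [Set.indicator_univ, condExp_const hm] at this

theorem negMulLog_le_one {x : ℝ} (hx : 0 ≤ x) : Real.negMulLog x ≤ 1 :=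
  (Real.negMulLog_le_one_sub_self hx).trans (by linarith)

theorem abs_negMulLog_le_one {x : ℝ} (h0 : 0 ≤ x) (h1 : x ≤ 1) : |Real.negMulLog x| ≤ 1 := by
  rw [abs_of_nonneg (Real.negMulLog_nonneg h0 h1)]
  exact negMulLog_le_one h0

theorem integrable_negMulLog_comp {f : Y → ℝ} (hf : AEStronglyMeasurable f ν)
    (h0 : 0 ≤ᵐ[ν] f) (h1 : f ≤ᵐ[ν] fun _ => 1) :
    Integrable (fun y => Real.negMulLog (f y)) ν := by
  refine Integrable.of_bound (Real.continuous_negMulLog.comp_aestronglyMeasurable hf) 1 ?_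
  filter_upwards [h0, h1] with y hy0 hy1
  exact abs_negMulLog_le_one hy0 hy1

theorem integrable_negMulLog_condExp (hm : m ≤ D) {s : Set Y} (hs : MeasurableSet s) :
    Integrable (fun y => Real.negMulLog ((ν[s.indicator (fun _ => (1 : ℝ)) | m]) y)) ν :=
  integrable_negMulLog_comp integrable_condExp.aestronglyMeasurable (condExp_indicator_nonneg s)
    (condExp_indicator_le_one hm hs)

/-- Bayes' rule: the conditional probability of `s ⊆ B` with respect to a `σ`-algebra `m'` whose
trace on `B` agrees with the trace of `m`. -/
theorem condExp_indicator_of_trace_eq (hmm' : m ≤ m') (hm' : m' ≤ D)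
    {s B : Set Y} (hs : MeasurableSet s) (hB : MeasurableSet[m'] B) (hsB : s ⊆ B)
    (htr : ∀ T, MeasurableSet[m'] T → ∃ S, MeasurableSet[m] S ∧ T ∩ B = S ∩ B) :
    B.indicator (fun y => (ν[s.indicator (fun _ => (1 : ℝ)) | m]) y /
      (ν[B.indicator (fun _ => (1 : ℝ)) | m]) y) =ᵐ[ν]
      ν[s.indicator (fun _ => (1 : ℝ)) | m'] := by
  have hm : m ≤ D := hmm'.trans hm'
  have hBD : MeasurableSet B := hm' B hB
  set p := ν[s.indicator (fun _ => (1 : ℝ)) | m] with hp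
  set q := ν[B.indicator (fun _ => (1 : ℝ)) | m] with hq
  set r : Y → ℝ := fun y => p y / q y with hr
  have hp0 : 0 ≤ᵐ[ν] p := condExp_indicator_nonneg (m := m) s
  have hpq : p ≤ᵐ[ν] q := condExp_indicator_mono hs hBD hsB
  have hrm : StronglyMeasurable[m] r :=
    (stronglyMeasurable_condExp.measurable.div
      stronglyMeasurable_condExp.measurable).stronglyMeasurable
  have hrb : ∀ᵐ y ∂ν, ‖r y‖ ≤ 1 := by
    filter_upwards [hp0, hpq] with y h0 h1
    have h0' : 0 ≤ p y := h0
    rw [Real.norm_eq_abs, abs_of_nonneg (div_nonneg h0' (h0'.trans h1))]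
    exact div_le_one_of_le₀ h1 (h0'.trans h1)
  have hrint : Integrable r ν := Integrable.of_bound (hrm.mono hm).aestronglyMeasurable 1 hrb
  have hrq : r * q =ᵐ[ν] p := by
    filter_upwards [hp0, hpq] with y h0 h1
    have h0' : 0 ≤ p y := h0
    simp only [Pi.mul_apply, hr]
    -- Where `q` vanishes so does `p`, so the convention x / 0 = 0 does no harm.
    by_cases hqy : q y = 0
    · rw [hqy] at h1 ⊢
      simp [le_antisymm h1 h0']
    · field_simp
  have hpull : ν[r * B.indicator (fun _ => (1 : ℝ)) | m] =ᵐ[ν] p :=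
    (condExp_stronglyMeasurable_mul_of_bound hm hrm (integrable_indicator_one hBD) 1 hrb).trans hrq
  have hrB : r * B.indicator (fun _ => (1 : ℝ)) = B.indicator r := by
    ext y
    by_cases hy : y ∈ B <;> simp [hy]
  have hrBint : Integrable (B.indicator r) ν := hrint.indicator hBD
  refine ae_eq_condExp_of_forall_setIntegral_eq hm' (integrable_indicator_one hs)
    (fun T _ _ => hrBint.integrableOn) ?_
    ((hrm.mono hmm').indicator hB).aestronglyMeasurable
  -- Inside `B` the set `T` may be exchanged for an `m`-measurable `S`, over which the defining
  -- property of conditional expectation given `m` applies.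
  intro T hT _
  obtain ⟨S, hS, hTS⟩ := htr T hT
  have hTD := hm' T hT
  have hSD := hm S hS
  calc ∫ y in T, B.indicator r y ∂ν = ∫ y in S, B.indicator r y ∂ν := by
        rw [setIntegral_indicator hBD, setIntegral_indicator hBD, hTS]
    _ = ∫ y in S, (ν[r * B.indicator (fun _ => (1 : ℝ)) | m]) y ∂ν := by
        rw [hrB, setIntegral_condExp hm hrBint hS]
    _ = ∫ y in S, p y ∂ν := integral_congr_ae (ae_restrict_of_ae hpull)
    _ = ∫ y in S, s.indicator (fun _ => (1 : ℝ)) y ∂ν :=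
        setIntegral_condExp hm (integrable_indicator_one hs) hS
    _ = ∫ y in T, s.indicator (fun _ => (1 : ℝ)) y ∂ν := by
        rw [setIntegral_indicator hs, setIntegral_indicator hs]
        have : S ∩ s = T ∩ s := by
          rw [← Set.inter_eq_right.2 hsB, ← Set.inter_assoc, ← Set.inter_assoc, hTS]
        rw [this]

theorem condExp_aeMeasurableSpace (hm : m ≤ D) {f : Y → ℝ} (hf : Integrable f ν) :
    ν[f | m] =ᵐ[ν] ν[f | aeMeasurableSpace m ν] := by
  refine ae_eq_condExp_of_forall_setIntegral_eq aeMeasurableSpace_le hf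
    (fun T _ _ => integrable_condExp.integrableOn) ?_
    (stronglyMeasurable_condExp.mono (le_aeMeasurableSpace hm)).aestronglyMeasurable
  rintro S ⟨-, T, hT, hST⟩ _
  rw [setIntegral_congr_set hST, setIntegral_condExp hm hf hT, setIntegral_congr_set hST]

/-- Invariance of `m` holds only modulo null sets, so y ↦ g • y need not be `m`-measurable. It is
measurable for `aeMeasurableSpace m ν`, which has the same conditional expectations, and there the
change of variables is exact. -/
theorem condExp_comp_smul {G : Type*} [Group G] [MulAction G Y] [MeasurableConstSMul G Y]
    [SMulInvariantMeasure G Y ν] (hm : m ≤ D) (hinv : IsInvariantSigma G m ν) {s : Set Y}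
    (hs : MeasurableSet s) (g : G) :
    (fun y => (ν[s.indicator (fun _ => (1 : ℝ)) | aeMeasurableSpace m ν]) (g • y)) =ᵐ[ν]
      ν[((fun y : Y => g • y) ⁻¹' s).indicator (fun _ => (1 : ℝ)) | m] := by
  have hm' : aeMeasurableSpace m ν ≤ D := aeMeasurableSpace_le
  have hmp : ∀ g : G, MeasurePreserving (fun y : Y => g • y) ν ν := fun g =>
    measurePreserving_smul g ν
  have hpre : ∀ (g : G) (S : Set Y), MeasurableSet[aeMeasurableSpace m ν] S →
      MeasurableSet[aeMeasurableSpace m ν] ((fun y : Y => g • y) ⁻¹' S) := by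
    rintro g S ⟨hS, T, hT, hST⟩
    obtain ⟨B, hB, hTB⟩ := (hinv g).1 T hT
    exact ⟨measurable_const_smul g hS, B, hB,
      ((hmp g).quasiMeasurePreserving.preimage_ae_eq hST).trans hTB⟩
  have hgs : MeasurableSet ((fun y : Y => g • y) ⁻¹' s) := measurable_const_smul g hs
  refine EventuallyEq.trans ?_ (condExp_aeMeasurableSpace hm (integrable_indicator_one hgs)).symm
  have hint : Integrable (fun y =>
      (ν[s.indicator (fun _ => (1 : ℝ)) | aeMeasurableSpace m ν]) (g • y)) ν :=
    (hmp g).integrable_comp_of_integrable integrable_condExp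
  refine ae_eq_condExp_of_forall_setIntegral_eq hm' (integrable_indicator_one hgs)
    (fun T _ _ => hint.integrableOn) ?_ ?_
  · intro S hS _
    have hST : S = (fun y : Y => g • y) ⁻¹' ((fun y : Y => g⁻¹ • y) ⁻¹' S) := by
      ext y; simp
    have hT := hpre g⁻¹ S hS
    set T := (fun y : Y => g⁻¹ • y) ⁻¹' S
    have hemb : MeasurableEmbedding (fun y : Y => g • y) := measurableEmbedding_const_smul g
    rw [hST, (hmp g).setIntegral_preimage_emb hemb,
      setIntegral_condExp hm' (integrable_indicator_one hs) hT,
      ← (hmp g).setIntegral_preimage_emb hemb]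
    rfl
  · have hmeas : Measurable[aeMeasurableSpace m ν, aeMeasurableSpace m ν]
        (fun y : Y => g • y) := fun S hS => hpre g S hS
    exact (StronglyMeasurable.comp_measurable stronglyMeasurable_condExp
      hmeas).aestronglyMeasurable

end CondProb

/-! ### Conditional entropy: monotonicity, invariance, chain rule, continuity. -/

section Entropy

/-- The sets that agree on `B` with an `m`-measurable set. -/
abbrev traceMeasurableSpace {Y : Type*} (m : MeasurableSpace Y) (B : Set Y) :
    MeasurableSpace Y where
  MeasurableSet' T := ∃ S, MeasurableSet[m] S ∧ T ∩ B = S ∩ B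
  measurableSet_empty := ⟨∅, @MeasurableSet.empty Y m, rfl⟩
  measurableSet_compl := by
    rintro T ⟨S, hS, hTS⟩
    refine ⟨Sᶜ, hS.compl, ?_⟩
    ext y
    have := Set.ext_iff.1 hTS y
    simp only [Set.mem_inter_iff, Set.mem_compl_iff] at this ⊢
    tauto
  measurableSet_iUnion := by
    intro T hT
    choose S hS hTS using hT
    exact ⟨⋃ n, S n, MeasurableSet.iUnion hS, by simp only [Set.iUnion_inter, hTS]⟩

variable {ι κ Y : Type*} {m m' : MeasurableSpace Y} [D : MeasurableSpace Y]
  {ν : Measure Y}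

namespace MeasPartition

theorem sigma_le (β : MeasPartition κ Y) : β.sigma ≤ D := by
  refine MeasurableSpace.generateFrom_le ?_
  rintro _ ⟨j, rfl⟩
  exact β.measurable_part j

theorem measurableSet_sigma (β : MeasPartition κ Y) (j : κ) : MeasurableSet[β.sigma] (β.part j) :=
  MeasurableSpace.measurableSet_generateFrom ⟨j, rfl⟩

theorem exists_mem_part (β : MeasPartition κ Y) (y : Y) : ∃ j, y ∈ β.part j :=
  Set.mem_iUnion.1 (β.iUnion_part.symm ▸ Set.mem_univ y)

theorem eq_of_mem_part (β : MeasPartition κ Y) {y : Y} {j j' : κ} (h : y ∈ β.part j)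
    (h' : y ∈ β.part j') : j = j' := by
  by_contra hne
  exact Set.disjoint_left.1 (β.disjoint_part j j' hne) h h'

/-- Each member of a partition `β` has the same trace of `β ∨ m` as of `m`. -/
theorem exists_trace_eq (β : MeasPartition κ Y) (j : κ) {T : Set Y}
    (hT : MeasurableSet[β.sigma ⊔ m] T) :
    ∃ S, MeasurableSet[m] S ∧ T ∩ β.part j = S ∩ β.part j := by
  have hdisj : ∀ j', j' ≠ j → β.part j' ∩ β.part j = ∅ := fun j' h =>
    (β.disjoint_part j' j h).inter_eq
  have hle : β.sigma ⊔ m ≤ traceMeasurableSpace m (β.part j) := by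
    refine sup_le (MeasurableSpace.generateFrom_le ?_) fun S hS => ⟨S, hS, rfl⟩
    rintro _ ⟨j', rfl⟩
    by_cases h : j' = j
    · exact ⟨Set.univ, @MeasurableSet.univ Y m, by simp [h]⟩
    · exact ⟨∅, @MeasurableSet.empty Y m, by rw [hdisj j' h, Set.empty_inter]⟩
  exact hle T hT

end MeasPartition

theorem condEntropy_eq_sum [Finite ι] [Fintype ι] (α : MeasPartition ι Y) :
    condEntropy m ν α =
      ∑ i, ∫ y, Real.negMulLog ((ν[(α.part i).indicator (fun _ => (1 : ℝ)) | m]) y) ∂ν :=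
  finsum_eq_sum_of_fintype _

variable [Finite ι]

theorem condEntropy_congr_equiv [Finite κ] {α : MeasPartition ι Y} {β : MeasPartition κ Y} (e : ι ≃ κ)
    (h : ∀ i, α.part i = β.part (e i)) : condEntropy m ν α = condEntropy m ν β := by
  unfold condEntropy
  simp only [h]
  exact finsum_comp_equiv e
    (f := fun j => ∫ y, Real.negMulLog ((ν[(β.part j).indicator (fun _ => (1 : ℝ)) | m]) y) ∂ν)

variable [IsProbabilityMeasure ν]

theorem condEntropy_nonneg (hm : m ≤ D) (α : MeasPartition ι Y) : 0 ≤ condEntropy m ν α := by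
  refine finsum_nonneg fun i => integral_nonneg_of_ae ?_
  filter_upwards [condExp_indicator_nonneg (m := m) (ν := ν) (α.part i),
    condExp_indicator_le_one (ν := ν) hm (α.measurable_part i)] with y h0 h1
  exact Real.negMulLog_nonneg h0 h1

theorem condEntropy_le_card (hm : m ≤ D) (α : MeasPartition ι Y) :
    condEntropy m ν α ≤ Nat.card ι := by
  have := Fintype.ofFinite ι
  rw [condEntropy_eq_sum, Nat.card_eq_fintype_card]
  have h : ∀ i ∈ (Finset.univ : Finset ι),
      ∫ y, Real.negMulLog ((ν[(α.part i).indicator (fun _ => (1 : ℝ)) | m]) y) ∂ν ≤ 1 := by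
    intro i _
    refine le_of_le_of_eq (b := ∫ _ : Y, (1 : ℝ) ∂ν) ?_ (by simp)
    refine integral_mono_ae (integrable_negMulLog_condExp hm (α.measurable_part i))
      (integrable_const 1) ?_
    filter_upwards [condExp_indicator_nonneg (m := m) (ν := ν) (α.part i)] with y h0
    exact negMulLog_le_one h0
  simpa using Finset.sum_le_card_nsmul _ _ _ h

/-- Conditional Jensen for the concave function `Real.negMulLog`, applied to the conditional
probability given `m'`, followed by the tower property. -/
theorem condEntropy_antitone (hmm' : m ≤ m') (hm' : m' ≤ D) (α : MeasPartition ι Y) :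
    condEntropy m' ν α ≤ condEntropy m ν α := by
  have hm := hmm'.trans hm'
  have := Fintype.ofFinite ι
  rw [condEntropy_eq_sum, condEntropy_eq_sum]
  refine Finset.sum_le_sum fun i _ => ?_
  have hs := α.measurable_part i
  set f := (α.part i).indicator (fun _ => (1 : ℝ)) with hf
  have hint := integrable_negMulLog_condExp (ν := ν) hm' hs
  have hJ := Real.concaveOn_negMulLog.neg.map_condExp_le (μ := ν) (f := ν[f | m']) hm
    Real.continuous_negMulLog.neg.continuousOn.lowerSemicontinuousOn
    (condExp_indicator_nonneg (α.part i)) isClosed_Ici integrable_condExp hint.neg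
  rw [← integral_condExp hm (f := fun y => Real.negMulLog ((ν[f | m']) y))]
  refine integral_mono_ae integrable_condExp (integrable_negMulLog_condExp hm hs) ?_
  filter_upwards [hJ, condExp_condExp_of_le (f := f) (μ := ν) hmm' hm',
    condExp_neg (fun y => Real.negMulLog ((ν[f | m']) y)) m (μ := ν)] with y h1 h2 h3
  simp only [Function.comp_apply, Pi.neg_apply, h2] at h1
  have h4 : (-Real.negMulLog) ∘ ν[f | m'] = -fun y => Real.negMulLog ((ν[f | m']) y) := rfl
  rw [h4, h3, Pi.neg_apply] at h1
  linarith

theorem condEntropy_preimage_smul [Finite κ] {G : Type*} [Group G] [MulAction G Y]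
    [MeasurableConstSMul G Y] [SMulInvariantMeasure G Y ν] (hm : m ≤ D)
    (hinv : IsInvariantSigma G m ν) {α : MeasPartition ι Y} {β : MeasPartition κ Y} (e : ι ≃ κ)
    (g : G) (h : ∀ i, α.part i = (fun y : Y => g • y) ⁻¹' β.part (e i)) :
    condEntropy m ν α = condEntropy m ν β := by
  have hmp : MeasurePreserving (fun y : Y => g • y) ν ν := measurePreserving_smul g ν
  have hemb : MeasurableEmbedding (fun y : Y => g • y) := measurableEmbedding_const_smul g
  unfold condEntropy
  rw [← finsum_comp_equiv e]
  refine finsum_congr fun i => ?_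
  have hs := β.measurable_part (e i)
  have h1 : ∫ y, Real.negMulLog ((ν[(β.part (e i)).indicator (fun _ => (1 : ℝ)) | m]) y) ∂ν =
      ∫ y, Real.negMulLog ((ν[(β.part (e i)).indicator (fun _ => (1 : ℝ)) |
        aeMeasurableSpace m ν]) y) ∂ν := by
    refine integral_congr_ae ?_
    filter_upwards [condExp_aeMeasurableSpace hm (integrable_indicator_one hs)] with y hy
    rw [hy]
  rw [h i]
  refine Eq.trans ?_ ((hmp.integral_comp hemb _).trans h1.symm)
  refine integral_congr_ae ?_
  filter_upwards [condExp_comp_smul hm hinv hs g] with y hy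
  rw [← hy]

theorem sum_indicator_one_inter [Fintype κ] (β : MeasPartition κ Y) (s : Set Y) :
    ∑ j, (s ∩ β.part j).indicator (fun _ => (1 : ℝ)) = s.indicator fun _ => 1 := by
  classical
  ext y
  obtain ⟨j₀, hj₀⟩ := β.exists_mem_part y
  rw [Finset.sum_apply, Finset.sum_eq_single j₀]
  · by_cases hy : y ∈ s <;> simp [hy, hj₀]
  · intro j _ hj
    exact Set.indicator_of_notMem (fun h => hj (β.eq_of_mem_part h.2 hj₀)) _
  · simp

theorem condExp_indicator_sum_inter [Fintype κ] (β : MeasPartition κ Y) {s : Set Y}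
    (hs : MeasurableSet s) :
    ν[s.indicator (fun _ => (1 : ℝ)) | m] =ᵐ[ν]
      ∑ j, ν[(s ∩ β.part j).indicator (fun _ => (1 : ℝ)) | m] := by
  rw [← sum_indicator_one_inter β s]
  exact condExp_finsetSum
    (fun j _ => integrable_indicator_one (hs.inter (β.measurable_part j))) m

/-- The conditional probability given `β ∨ m`, in terms of those given `m`. -/
theorem condExp_indicator_sigma_sup [Fintype κ] (hm : m ≤ D) (β : MeasPartition κ Y) {s : Set Y}
    (hs : MeasurableSet s) :
    ∀ᵐ y ∂ν, ∀ j, y ∈ β.part j → (ν[s.indicator (fun _ => (1 : ℝ)) | β.sigma ⊔ m]) y =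
      (ν[(s ∩ β.part j).indicator (fun _ => (1 : ℝ)) | m]) y /
        (ν[(β.part j).indicator (fun _ => (1 : ℝ)) | m]) y := by
  classical
  have h : ∀ j, _ := fun j => condExp_indicator_of_trace_eq (ν := ν) (m := m)
    (m' := β.sigma ⊔ m) le_sup_right (sup_le β.sigma_le hm) (hs.inter (β.measurable_part j))
    (le_sup_left (α := MeasurableSpace Y) _ (β.measurableSet_sigma j)) Set.inter_subset_right
    (fun T hT => β.exists_trace_eq j hT)
  filter_upwards [condExp_indicator_sum_inter (ν := ν) (m := β.sigma ⊔ m) β hs,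
    ae_all_iff.2 h] with y hy hj j hyj
  rw [hy, Finset.sum_apply, Finset.sum_eq_single j]
  · rw [← hj j, Set.indicator_of_mem hyj]
  · intro j' _ hne
    rw [← hj j', Set.indicator_of_notMem fun h => hne (β.eq_of_mem_part h hyj)]
  · simp

theorem integral_mul_condExp_indicator (hm : m ≤ D) {B : Set Y} (hB : MeasurableSet B)
    {f : Y → ℝ} (hf : StronglyMeasurable[m] f) {c : ℝ} (hc : ∀ᵐ y ∂ν, ‖f y‖ ≤ c) :
    ∫ y, B.indicator f y ∂ν = ∫ y, f y * (ν[B.indicator (fun _ => (1 : ℝ)) | m]) y ∂ν := by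
  have h := condExp_stronglyMeasurable_mul_of_bound hm hf
    (integrable_indicator_one (ν := ν) hB) c hc
  have hfB : f * B.indicator (fun _ => (1 : ℝ)) = B.indicator f := by
    ext y
    by_cases hy : y ∈ B <;> simp [hy]
  rw [← integral_condExp hm, ← hfB]
  exact integral_congr_ae h

/-- On the j-th member of `β` the conditional probability is the `m`-measurable quotient from Bayes'
rule, and integrating an `m`-measurable function over that member amounts to weighting it with the
member's conditional probability. -/
theorem integral_negMulLog_condExp_sigma_sup [Fintype κ] (hm : m ≤ D) (β : MeasPartition κ Y)
    {s : Set Y} (hs : MeasurableSet s) :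
    ∫ y, Real.negMulLog ((ν[s.indicator (fun _ => (1 : ℝ)) | β.sigma ⊔ m]) y) ∂ν =
      ∑ j, ∫ y, Real.negMulLog ((ν[(s ∩ β.part j).indicator (fun _ => (1 : ℝ)) | m]) y /
        (ν[(β.part j).indicator (fun _ => (1 : ℝ)) | m]) y) *
          (ν[(β.part j).indicator (fun _ => (1 : ℝ)) | m]) y ∂ν := by
  classical
  set p : κ → Y → ℝ := fun j => ν[(s ∩ β.part j).indicator (fun _ => (1 : ℝ)) | m] with hp
  set q : κ → Y → ℝ := fun j => ν[(β.part j).indicator (fun _ => (1 : ℝ)) | m] with hq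
  have hmeas : ∀ j, StronglyMeasurable[m] fun y => Real.negMulLog (p j y / q j y) := fun j =>
    Real.continuous_negMulLog.comp_stronglyMeasurable
      (stronglyMeasurable_condExp.measurable.div
        stronglyMeasurable_condExp.measurable).stronglyMeasurable
  have hbound : ∀ j, ∀ᵐ y ∂ν, ‖Real.negMulLog (p j y / q j y)‖ ≤ 1 := by
    intro j
    filter_upwards [condExp_indicator_nonneg (m := m) (ν := ν) (s ∩ β.part j),
      condExp_indicator_mono (m := m) (ν := ν) (hs.inter (β.measurable_part j))
        (β.measurable_part j) Set.inter_subset_right] with y h0 h1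
    have h0' : 0 ≤ p j y := h0
    have h1' : p j y ≤ q j y := h1
    exact abs_negMulLog_le_one (div_nonneg h0' (h0'.trans h1'))
      (div_le_one_of_le₀ h1' (h0'.trans h1'))
  have hint : ∀ j, Integrable
      ((β.part j).indicator fun y => Real.negMulLog (p j y / q j y)) ν := fun j =>
    (Integrable.of_bound ((hmeas j).mono hm).aestronglyMeasurable 1 (hbound j)).indicator
      (β.measurable_part j)
  have h1 : ∀ j, ∫ y, Real.negMulLog (p j y / q j y) * q j y ∂ν =
      ∫ y, (β.part j).indicator (fun y => Real.negMulLog (p j y / q j y)) y ∂ν := fun j =>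
    (integral_mul_condExp_indicator hm (β.measurable_part j) (hmeas j) (hbound j)).symm
  change _ = ∑ j, ∫ y, Real.negMulLog (p j y / q j y) * q j y ∂ν
  simp only [h1]
  rw [← integral_finsetSum _ fun j _ => hint j]
  refine integral_congr_ae ?_
  filter_upwards [condExp_indicator_sigma_sup (ν := ν) hm β hs] with y hy
  obtain ⟨j, hj⟩ := β.exists_mem_part y
  rw [Finset.sum_eq_single j, hy j hj, Set.indicator_of_mem hj]
  · intro j' _ hne
    exact Set.indicator_of_notMem (fun h => hne (β.eq_of_mem_part h hj)) _
  · simp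

theorem negMulLog_div_mul {p q : ℝ} (h0 : 0 ≤ p) (h1 : p ≤ q) :
    Real.negMulLog (p / q) * q = Real.negMulLog p + p * Real.log q := by
  rcases eq_or_ne q 0 with rfl | hq
  · simp [le_antisymm h1 h0]
  · rcases eq_or_ne p 0 with rfl | hp
    · simp
    · simp only [Real.negMulLog, Real.log_div hp hq]
      field_simp
      ring

/-- The chain rule for conditional entropy. -/
theorem condEntropy_join [Finite κ] (hm : m ≤ D) (α : MeasPartition ι Y) (β : MeasPartition κ Y) :
    condEntropy m ν (α.join β) = condEntropy m ν β + condEntropy (β.sigma ⊔ m) ν α := by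
  have := Fintype.ofFinite ι
  have := Fintype.ofFinite κ
  rw [condEntropy_eq_sum, condEntropy_eq_sum, condEntropy_eq_sum]
  simp only [fun i => integral_negMulLog_condExp_sigma_sup (ν := ν) hm β (α.measurable_part i)]
  rw [Fintype.sum_prod_type, Finset.sum_comm, Finset.sum_comm (γ := ι), ← Finset.sum_add_distrib]
  refine Finset.sum_congr rfl fun j _ => ?_
  have hB := β.measurable_part j
  set q := ν[(β.part j).indicator (fun _ => (1 : ℝ)) | m] with hq
  have hAB : ∀ i, MeasurableSet (α.part i ∩ β.part j) := fun i => (α.measurable_part i).inter hB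
  have hsum := condExp_indicator_sum_inter (ν := ν) (m := m) α hB
  have hae : ∀ᵐ y ∂ν, ∀ i,
      Real.negMulLog ((ν[(α.part i ∩ β.part j).indicator (fun _ => (1 : ℝ)) | m]) y / q y) * q y =
      Real.negMulLog ((ν[(α.part i ∩ β.part j).indicator (fun _ => (1 : ℝ)) | m]) y) +
        (ν[(α.part i ∩ β.part j).indicator (fun _ => (1 : ℝ)) | m]) y * Real.log (q y) := by
    refine ae_all_iff.2 fun i => ?_
    filter_upwards [condExp_indicator_nonneg (m := m) (ν := ν) (α.part i ∩ β.part j),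
      condExp_indicator_mono (m := m) (ν := ν) (hAB i) hB Set.inter_subset_right] with y h0 h1
    exact negMulLog_div_mul h0 h1
  have hpi := fun i => integrable_negMulLog_condExp (ν := ν) hm (hAB i)
  have hqi := integrable_negMulLog_condExp (ν := ν) hm hB
  have hri : ∀ i, Integrable (fun y => Real.negMulLog
      ((ν[(α.part i ∩ β.part j).indicator (fun _ => (1 : ℝ)) | m]) y / q y) * q y) ν := by
    intro i
    refine Integrable.of_bound (C := 1) ?_ ?_
    · exact (Real.continuous_negMulLog.comp_aestronglyMeasurable
        (integrable_condExp.aestronglyMeasurable.div₀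
          integrable_condExp.aestronglyMeasurable)).mul integrable_condExp.aestronglyMeasurable
    · filter_upwards [condExp_indicator_nonneg (m := m) (ν := ν) (α.part i ∩ β.part j),
        condExp_indicator_mono (m := m) (ν := ν) (hAB i) hB Set.inter_subset_right,
        condExp_indicator_le_one (ν := ν) hm hB] with y h0 h1 h2
      have h0' : 0 ≤ (ν[(α.part i ∩ β.part j).indicator (fun _ => (1 : ℝ)) | m]) y := h0
      have hq0 : 0 ≤ q y := h0'.trans h1
      rw [Real.norm_eq_abs, abs_mul, abs_of_nonneg hq0]
      exact mul_le_one₀ (abs_negMulLog_le_one (div_nonneg h0' hq0) (div_le_one_of_le₀ h1 hq0))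
        hq0 h2
  rw [← integral_finsetSum _ fun i _ => hri i]
  simp only [MeasPartition.join]
  rw [← integral_finsetSum _ fun i _ => hpi i,
    ← integral_add hqi (integrable_finsetSum _ fun i _ => hri i)]
  refine integral_congr_ae ?_
  filter_upwards [hae, hsum] with y hy hs
  -- The terms p_i log q sum to q log q, which cancels the contribution of `β`.
  simp only [hy, Finset.sum_add_distrib, ← Finset.sum_mul]
  have hs' : q y = ∑ i, (ν[(α.part i ∩ β.part j).indicator (fun _ => (1 : ℝ)) | m]) y := by
    rw [hq, hs, Finset.sum_apply]
    simp only [Set.inter_comm]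
  rw [← hs', Real.negMulLog]
  ring

/-- Continuity of conditional entropy along increasing sequences of `σ`-algebras. -/
theorem tendsto_condEntropy_iSup {ℱ : ℕ → MeasurableSpace Y} (hmono : Monotone ℱ)
    (hle : ∀ n, ℱ n ≤ D) (α : MeasPartition ι Y) :
    Tendsto (fun n => condEntropy (ℱ n) ν α) atTop (𝓝 (condEntropy (⨆ n, ℱ n) ν α)) := by
  have := Fintype.ofFinite ι
  simp only [condEntropy_eq_sum]
  refine tendsto_finsetSum _ fun i _ => ?_
  have hs := α.measurable_part i
  refine tendsto_integral_of_dominated_convergence (fun _ => 1)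
    (fun n => (integrable_negMulLog_condExp (hle n) hs).aestronglyMeasurable)
    (integrable_const 1) (fun n => ?_) ?_
  · filter_upwards [condExp_indicator_nonneg (m := ℱ n) (ν := ν) (α.part i),
      condExp_indicator_le_one (ν := ν) (hle n) hs] with y h0 h1
    exact abs_negMulLog_le_one h0 h1
  -- Lévy's upward theorem.
  · filter_upwards [tendsto_ae_condExp (μ := ν) (ℱ := ⟨ℱ, hmono, hle⟩)
      ((α.part i).indicator fun _ => (1 : ℝ))] with y hy
    exact (Real.continuous_negMulLog.tendsto _).comp hy

end Entropy

/-! ### Iterated partitions and dynamical entropy. -/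

section Iter

variable {G ι κ Y : Type*} [Group G] [MulAction G Y] {m m' : MeasurableSpace Y}
  [D : MeasurableSpace Y] [MeasurableConstSMul G Y] {ν : Measure Y}

namespace MeasPartition

theorem mem_iter_part {α : MeasPartition ι Y} {F : Finset G} {φ : F → ι} {y : Y} :
    y ∈ (α.iter F).part φ ↔ ∀ g : F, (g : G) • y ∈ α.part (φ g) := by
  simp [iter]

theorem measurableSet_iter_part (α : MeasPartition ι Y) {F : Finset G}
    (h : ∀ g ∈ F, ∀ i, MeasurableSet[m] ((fun y : Y => g • y) ⁻¹' α.part i)) (φ : F → ι) :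
    MeasurableSet[m] ((α.iter F).part φ) :=
  MeasurableSet.iInter fun g => h g g.2 (φ g)

theorem iter_sigma_le (α : MeasPartition ι Y) {F : Finset G}
    (h : ∀ g ∈ F, ∀ i, MeasurableSet[m] ((fun y : Y => g • y) ⁻¹' α.part i)) :
    (α.iter F).sigma ≤ m := by
  refine MeasurableSpace.generateFrom_le ?_
  rintro _ ⟨φ, rfl⟩
  exact α.measurableSet_iter_part h φ

theorem measurableSet_preimage_iter_sigma [Finite ι] (α : MeasPartition ι Y) {F : Finset G}
    {g : G} (hg : g ∈ F) (i : ι) :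
    MeasurableSet[(α.iter F).sigma] ((fun y : Y => g • y) ⁻¹' α.part i) := by
  have h : (fun y : Y => g • y) ⁻¹' α.part i =
      ⋃ φ : {φ : F → ι // φ ⟨g, hg⟩ = i}, (α.iter F).part φ := by
    ext y
    simp only [Set.mem_preimage, Set.mem_iUnion]
    constructor
    · intro hy
      obtain ⟨φ, hφ⟩ := (α.iter F).exists_mem_part y
      exact ⟨⟨φ, α.eq_of_mem_part (mem_iter_part.1 hφ ⟨g, hg⟩) hy⟩, hφ⟩
    · rintro ⟨⟨φ, rfl⟩, hφ⟩
      exact mem_iter_part.1 hφ ⟨g, hg⟩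
  rw [h]
  exact MeasurableSet.iUnion fun φ => (α.iter F).measurableSet_sigma φ

theorem iter_sigma_mono [Finite ι] (α : MeasPartition ι Y) {E F : Finset G} (h : E ⊆ F) :
    (α.iter E).sigma ≤ (α.iter F).sigma :=
  α.iter_sigma_le fun _ hg i => α.measurableSet_preimage_iter_sigma (h hg) i

theorem iter_sigma_le_sigmaGroup (α : MeasPartition ι Y) (F : Finset G) :
    (α.iter F).sigma ≤ α.sigmaGroup G :=
  α.iter_sigma_le fun g _ i => MeasurableSpace.measurableSet_generateFrom ⟨g, i, rfl⟩

theorem sigmaGroup_le (α : MeasPartition ι Y) : α.sigmaGroup G ≤ D := by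
  refine MeasurableSpace.generateFrom_le ?_
  rintro _ ⟨g, i, rfl⟩
  exact measurable_const_smul g (α.measurable_part i)

theorem iSup_iter_sigma [Finite ι] (α : MeasPartition ι Y) {E : ℕ → Finset G}
    (hE : ∀ g, ∃ n, g ∈ E n) :
    ⨆ n, ((α.iter (E n)).sigma ⊔ m) = α.sigmaGroup G ⊔ m := by
  refine le_antisymm (iSup_le fun n => sup_le_sup_right (α.iter_sigma_le_sigmaGroup _) m)
    (sup_le (MeasurableSpace.generateFrom_le ?_) (le_iSup_of_le 0 le_sup_right))
  rintro _ ⟨g, i, rfl⟩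
  obtain ⟨n, hn⟩ := hE g
  have hle : (α.iter (E n)).sigma ≤ ⨆ n, ((α.iter (E n)).sigma ⊔ m) :=
    le_iSup_of_le n le_sup_left
  exact hle _ (α.measurableSet_preimage_iter_sigma hn i)

end MeasPartition

/-- Restricting `φ : F c → ι` along the bijection `g ↦ g c` from `F` to `F c`. -/
noncomputable def translateEquiv [DecidableEq G] (ι : Type*) (F : Finset G) (c : G) :
    (((F.image fun k => k * c : Finset G) : Type _) → ι) ≃ (F → ι) :=
  Equiv.ofBijective (fun φ g => φ ⟨g * c, Finset.mem_image_of_mem _ g.2⟩) (by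
    constructor
    · intro φ ψ h
      ext ⟨x, hx⟩
      obtain ⟨k, hk, rfl⟩ := Finset.mem_image.1 hx
      exact congrFun h ⟨k, hk⟩
    · intro ψ
      refine ⟨fun x => ψ ⟨x * c⁻¹, ?_⟩, ?_⟩
      · obtain ⟨k, hk, hkx⟩ := Finset.mem_image.1 x.2
        rw [← hkx]
        simpa using hk
      · funext g
        simp)

/-- Since (k c) • y = k • (c • y), right translation of the index set is a preimage under `c`. This
is why right translates K c are the ones averaged over. -/
theorem MeasPartition.iter_image_mul_part [DecidableEq G] (α : MeasPartition ι Y) (F : Finset G) (c : G)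
    (φ : ((F.image fun k => k * c : Finset G) : Type _) → ι) :
    (α.iter (F.image fun k => k * c)).part φ =
      (fun y : Y => c • y) ⁻¹' (α.iter F).part (translateEquiv ι F c φ) := by
  ext y
  simp only [Set.mem_preimage, MeasPartition.mem_iter_part, Subtype.forall, translateEquiv,
    smul_smul]
  constructor
  · intro h k hk
    exact h _ _
  · intro h x hx
    obtain ⟨k, hk, rfl⟩ := Finset.mem_image.1 hx
    exact h k hk

variable [Finite ι] [Finite κ]

theorem condEntropy_iter_join (α : MeasPartition ι Y) (β : MeasPartition κ Y) (F : Finset G) :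
    condEntropy m ν ((α.join β).iter F) = condEntropy m ν ((α.iter F).join (β.iter F)) := by
  refine condEntropy_congr_equiv (Equiv.arrowProdEquivProdArrow F (fun _ => ι) (fun _ => κ)) ?_
  intro φ
  ext y
  simp only [MeasPartition.mem_iter_part, MeasPartition.join, Set.mem_inter_iff, forall_and,
    Equiv.arrowProdEquivProdArrow_apply]

theorem HasDynEntropy.dynEntropy {α : MeasPartition ι Y} {l : ℝ} (h : HasDynEntropy G m ν α l) :
    HasDynEntropy G m ν α (dynEntropy G m ν α) :=
  Classical.epsilon_spec (p := fun l => HasDynEntropy G m ν α l) ⟨l, h⟩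

theorem HasDynEntropy.unique {α : MeasPartition ι Y} {l l' : ℝ} {F : ℕ → Finset G}
    (hF : IsFolnerSeq F) (h : HasDynEntropy G m ν α l) (h' : HasDynEntropy G m ν α l') : l = l' :=
  tendsto_nhds_unique (h F hF) (h' F hF)

variable [IsProbabilityMeasure ν]

/-- Exhibits the marginal gain of `g` as a conditional entropy, from which monotonicity and
submodularity can be read off. -/
theorem condEntropy_iter_insert [DecidableEq G] (hm : m ≤ D) (α : MeasPartition ι Y) {g : G} {S : Finset G}
    (hg : g ∉ S) :
    condEntropy m ν (α.iter (insert g S)) = condEntropy m ν (α.iter S) +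
      condEntropy ((α.iter S).sigma ⊔ m) ν (α.iter {g}) := by
  rw [← condEntropy_join hm]
  set r : (((insert g S : Finset G) : Type _) → ι) → ((({g} : Finset G) : Type _) → ι) × (S → ι) :=
    fun φ => (fun x => φ ⟨x, Finset.mem_insert.2 (Or.inl (Finset.mem_singleton.1 x.2))⟩,
      fun x => φ ⟨x, Finset.mem_insert_of_mem x.2⟩) with hr
  have hbij : Function.Bijective r := by
    constructor
    · intro φ ψ h
      ext ⟨x, hx⟩
      rcases Finset.mem_insert.1 hx with rfl | hx'
      · exact congrFun (congrArg Prod.fst h) ⟨x, Finset.mem_singleton_self x⟩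
      · exact congrFun (congrArg Prod.snd h) ⟨x, hx'⟩
    · rintro ⟨φ, ψ⟩
      refine ⟨fun x => if h : (x : G) ∈ S then ψ ⟨x, h⟩ else
        φ ⟨g, Finset.mem_singleton_self g⟩, Prod.ext ?_ ?_⟩
      · funext ⟨x, hx⟩
        obtain rfl := Finset.mem_singleton.1 hx
        simp [hr, hg]
      · funext ⟨x, hx⟩
        simp [hr]
  refine condEntropy_congr_equiv (Equiv.ofBijective r hbij) fun φ => ?_
  ext y
  simp only [MeasPartition.join, Set.mem_inter_iff, MeasPartition.mem_iter_part, Subtype.forall,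
    Equiv.ofBijective_apply, hr]
  constructor
  · exact fun h => ⟨fun x hx => h x _, fun x hx => h x _⟩
  · rintro ⟨h1, h2⟩ x hx
    rcases Finset.mem_insert.1 hx with rfl | hx'
    · exact h1 x (Finset.mem_singleton_self x)
    · exact h2 x hx'

theorem condEntropy_iter_empty (hm : m ≤ D) (α : MeasPartition ι Y) :
    condEntropy m ν (α.iter (∅ : Finset G)) = 0 := by
  refine finsum_eq_zero_of_forall_eq_zero fun φ => ?_
  have : (α.iter (∅ : Finset G)).part φ = Set.univ :=
    Set.eq_univ_of_forall fun y => MeasPartition.mem_iter_part.2 fun g => absurd g.2 (Finset.notMem_empty _)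
  rw [this, Set.indicator_univ, condExp_const hm]
  simp

/-- The marginal gain is non-negative and decreases as the conditioning grows. No invariance of `m`
is needed, so `m` may be β_F ∨ C for a finite `F`. -/
theorem isSubmodularRank_condEntropy [DecidableEq G] (hm : m ≤ D) (α : MeasPartition ι Y) :
    IsSubmodularRank fun S : Finset G => condEntropy m ν (α.iter S) where
  empty := condEntropy_iter_empty hm α
  le_insert g S hg := by
    rw [condEntropy_iter_insert hm α hg]
    exact le_add_of_nonneg_right
      (condEntropy_nonneg (sup_le (α.iter S).sigma_le hm) (α.iter {g}))
  insert_sub_le g S T hST hg := by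
    rw [condEntropy_iter_insert hm α hg, condEntropy_iter_insert hm α fun h => hg (hST h),
      add_sub_cancel_left, add_sub_cancel_left]
    exact condEntropy_antitone (sup_le_sup_right (α.iter_sigma_mono hST) m)
      (sup_le (α.iter T).sigma_le hm) _

theorem condEntropy_iter_singleton_le (hm : m ≤ D) (α : MeasPartition ι Y) (g : G) :
    condEntropy m ν (α.iter {g}) ≤ Nat.card ι := by
  refine (condEntropy_le_card hm (α.iter {g})).trans (le_of_eq ?_)
  rw [Nat.card_fun, Nat.card_eq_fintype_card (α := ({g} : Finset G)), Fintype.card_coe, Finset.card_singleton, pow_one]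

theorem condEntropy_iter_image_mul [DecidableEq G] [SMulInvariantMeasure G Y ν]
    (hm : m ≤ D) (hinv : IsInvariantSigma G m ν)
    (α : MeasPartition ι Y) (F : Finset G) (c : G) :
    condEntropy m ν (α.iter (F.image fun k => k * c)) = condEntropy m ν (α.iter F) :=
  condEntropy_preimage_smul hm hinv (translateEquiv ι F c) c (α.iter_image_mul_part F c)

/-- `H(α_{K c} | β_{E c} ∨ m) = H(α_K | β_E ∨ m)` for an invariant `m`. -/
theorem condEntropy_iter_sigma_sup_image_mul [DecidableEq G] [SMulInvariantMeasure G Y ν]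
    (hm : m ≤ D) (hinv : IsInvariantSigma G m ν)
    (α : MeasPartition ι Y) (β : MeasPartition κ Y) (K E : Finset G) (c : G) :
    condEntropy ((β.iter (E.image fun k => k * c)).sigma ⊔ m) ν (α.iter (K.image fun k => k * c)) =
      condEntropy ((β.iter E).sigma ⊔ m) ν (α.iter K) := by
  -- As β_E ∨ m need not be invariant, both sides are written by the chain rule as differences of
  -- entropies given `m`.
  have h1 := condEntropy_join (ν := ν) hm (α.iter (K.image fun k => k * c))
    (β.iter (E.image fun k => k * c))
  have h2 := condEntropy_join (ν := ν) hm (α.iter K) (β.iter E)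
  have h3 : condEntropy m ν ((α.iter (K.image fun k => k * c)).join
      (β.iter (E.image fun k => k * c))) = condEntropy m ν ((α.iter K).join (β.iter E)) := by
    refine condEntropy_preimage_smul hm hinv
      ((translateEquiv ι K c).prodCongr (translateEquiv κ E c)) c fun φ => ?_
    simp only [MeasPartition.join, MeasPartition.iter_image_mul_part, Set.preimage_inter,
      Equiv.prodCongr_apply, Prod.map_fst, Prod.map_snd]
  have h4 := condEntropy_iter_image_mul (ν := ν) hm hinv β E c
  linarith

theorem exists_hasDynEntropy [SMulInvariantMeasure G Y ν]
    (hm : m ≤ D) (hinv : IsInvariantSigma G m ν)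
    (α : MeasPartition ι Y) : ∃ l, HasDynEntropy G m ν α l := by
  classical
  exact (isSubmodularRank_condEntropy hm α).exists_tendsto
    fun K c => condEntropy_iter_image_mul hm hinv α K c

theorem exists_condEntropy_iter_sigma_sup_lt [Countable G] (hm : m ≤ D) (α : MeasPartition ι Y)
    (β : MeasPartition κ Y) {a : ℝ} (h : condEntropy (β.sigmaGroup G ⊔ m) ν α < a) :
    ∃ E : Finset G, condEntropy ((β.iter E).sigma ⊔ m) ν α < a := by
  classical
  obtain ⟨e, he⟩ := exists_surjective_nat G
  have hmono : Monotone fun n : ℕ => (β.iter ((Finset.range n).image e)).sigma ⊔ m :=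
    fun n n' hn => sup_le_sup_right (β.iter_sigma_mono
      (Finset.image_subset_image (Finset.range_mono hn))) m
  have hlim := tendsto_condEntropy_iSup (ν := ν) hmono
    (fun n => sup_le (β.iter _).sigma_le hm) α
  rw [β.iSup_iter_sigma fun g => ?_] at hlim
  · obtain ⟨n, hn⟩ := (hlim.eventually_lt_const h).exists
    exact ⟨_, hn⟩
  · obtain ⟨n, rfl⟩ := he g
    exact ⟨n + 1, Finset.mem_image_of_mem e (by simp)⟩

theorem HasDynEntropy.tendsto_sigma_sup (hm : m ≤ D) {α : MeasPartition ι Y}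
    {β : MeasPartition κ Y} {a b : ℝ} (hab : HasDynEntropy G m ν (α.join β) a)
    (hb : HasDynEntropy G m ν β b) {F : ℕ → Finset G} (hF : IsFolnerSeq F) :
    Tendsto (fun n => condEntropy ((β.iter (F n)).sigma ⊔ m) ν (α.iter (F n)) / ((F n).card : ℝ))
      atTop (𝓝 (a - b)) := by
  refine ((hab F hF).sub (hb F hF)).congr fun n => ?_
  rw [condEntropy_iter_join, condEntropy_join hm]
  ring

/-- The limit of `H(α_F | β_F ∨ m) / |F|` is at most `H(α_K | β_G ∨ m) / |K|` for every `K`. -/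
theorem le_condEntropy_sigmaGroup_div_card [Countable G] [SMulInvariantMeasure G Y ν]
    (hm : m ≤ D)
    (hinv : IsInvariantSigma G m ν) {α : MeasPartition ι Y} {β : MeasPartition κ Y}
    {F : ℕ → Finset G} (hF : IsFolnerSeq F) {l : ℝ}
    (hl : Tendsto
      (fun n => condEntropy ((β.iter (F n)).sigma ⊔ m) ν (α.iter (F n)) / ((F n).card : ℝ))
      atTop (𝓝 l)) {K : Finset G} (hK : K.Nonempty) :
    l ≤ condEntropy (β.sigmaGroup G ⊔ m) ν (α.iter K) / K.card := by
  classical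
  have hKc : (0 : ℝ) < K.card := by exact_mod_cast hK.card_pos
  refine le_of_forall_pos_le_add fun ε hε => ?_
  -- The tolerance |K| ε/2 becomes ε/2 after division by |K|; the boundary error takes the other
  -- half.
  obtain ⟨E, hE⟩ := exists_condEntropy_iter_sigma_sup_lt (G := G) (ν := ν) hm (α.iter K) β
    (lt_add_of_pos_right _ (mul_pos hKc (half_pos hε)))
  -- The submodular function varies with `n`, its conditioning being β_{F n} ∨ m; the condition E c
  -- ⊆ F n is what bounds it uniformly on the translates K c.
  have hev := hF.eventually_div_card_le (K := K) (E := E)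
    (fun n => isSubmodularRank_condEntropy (ν := ν) (sup_le (β.iter (F n)).sigma_le hm) α)
    (fun n g => condEntropy_iter_singleton_le (sup_le (β.iter (F n)).sigma_le hm) α g) hK
    (condEntropy_nonneg (sup_le (β.iter E).sigma_le hm) (α.iter K))
    (fun n c _ hc => by
      rw [← condEntropy_iter_sigma_sup_image_mul hm hinv α β K E c]
      refine condEntropy_antitone (sup_le_sup_right (β.iter_sigma_mono ?_) m)
        (sup_le (β.iter (F n)).sigma_le hm) _
      intro x hx
      obtain ⟨e, he, rfl⟩ := Finset.mem_image.1 hx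
      exact hc e he) (half_pos hε)
  have hle := le_of_tendsto hl hev
  have : condEntropy ((β.iter E).sigma ⊔ m) ν (α.iter K) / K.card ≤
      condEntropy (β.sigmaGroup G ⊔ m) ν (α.iter K) / K.card + ε / 2 := by
    rw [div_le_iff₀ hKc]
    refine hE.le.trans (le_of_eq ?_)
    field_simp
  linarith

/-- The entropy given `β_G ∨ m` is the difference of the entropies of `α ∨ β` and `β`. -/
theorem HasDynEntropy.sub [Countable G] [SMulInvariantMeasure G Y ν]
    (hm : m ≤ D) (hinv : IsInvariantSigma G m ν)
    {α : MeasPartition ι Y} {β : MeasPartition κ Y} {a b : ℝ}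
    (hab : HasDynEntropy G m ν (α.join β) a) (hb : HasDynEntropy G m ν β b) :
    HasDynEntropy G (β.sigmaGroup G ⊔ m) ν α (a - b) := by
  intro F hF
  have hl := hab.tendsto_sigma_sup hm hb hF
  -- The lower bound is taken at K = F n, so it is the constant a - b.
  refine tendsto_of_tendsto_of_tendsto_of_le_of_le tendsto_const_nhds hl
    (fun n => le_condEntropy_sigmaGroup_div_card hm hinv hF hl (hF.nonempty n)) fun n => ?_
  exact div_le_div_of_nonneg_right
    (condEntropy_antitone (sup_le_sup_right (β.iter_sigma_le_sigmaGroup _) m)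
      (sup_le β.sigmaGroup_le hm) _) (Nat.cast_nonneg _)

end Iter

theorem theorem1007031233 {G Y ι κ : Type*} [Group G] [Countable G] (hG : IsAmenableGroup G)
    [MulAction G Y] (C : MeasurableSpace Y) [D : MeasurableSpace Y] (hC : C ≤ D)
    [MeasurableConstSMul G Y]
    (ν : Measure Y) [IsProbabilityMeasure ν] [SMulInvariantMeasure G Y ν]
    (hinv : IsInvariantSigma G C ν)
    [Finite ι] [Finite κ] (α : MeasPartition ι Y) (β : MeasPartition κ Y) :
    -- the three dynamical entropies exist as limits
    HasDynEntropy G C ν (α.join β) (dynEntropy G C ν (α.join β)) ∧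
    HasDynEntropy G C ν β (dynEntropy G C ν β) ∧
    HasDynEntropy G (β.sigmaGroup G ⊔ C) ν α (dynEntropy G (β.sigmaGroup G ⊔ C) ν α) ∧
    -- the relative Pinsker formula, along every Følner sequence
    (∀ F : ℕ → Finset G, IsFolnerSeq F →
      Tendsto
        (fun n => condEntropy ((β.iter (F n)).sigma ⊔ C) ν (α.iter (F n)) / ((F n).card : ℝ))
        atTop (𝓝 (dynEntropy G (β.sigmaGroup G ⊔ C) ν α))) ∧
    dynEntropy G C ν (α.join β) =
      dynEntropy G C ν β + dynEntropy G (β.sigmaGroup G ⊔ C) ν α := by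
  obtain ⟨_, h₁⟩ := exists_hasDynEntropy (G := G) hC hinv (α.join β)
  obtain ⟨_, h₂⟩ := exists_hasDynEntropy (G := G) hC hinv β
  have hαβ := h₁.dynEntropy
  have hβ := h₂.dynEntropy
  have hsub := hαβ.sub hC hinv hβ
  -- One Følner sequence is needed for the limit to be unique, and only here does amenability enter.
  obtain ⟨F₀, hF₀⟩ := hG.exists_isFolnerSeq
  have heq := hsub.dynEntropy.unique hF₀ hsub
  refine ⟨hαβ, hβ, hsub.dynEntropy, fun F hF => ?_, by linarith⟩
  rw [heq]
  exact hαβ.tendsto_sigma_sup hC hβ hF
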